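/- **Setting.** A featured graph is a finite undirected simple graph $G$ (with node set $\{0,\dots,n-1\}$) with node features $a_G(u)\in\mathbb R^d$. Let $\mathcal G$ be a set of featured graphs (for instance all of them), and let $\mathcal X=\mathcal G\otimes V=\{(G,u)\mid G\in\mathcal G,\ u\in V(G)\}$ and $\mathcal Z=\mathcal X\times\{0,1\}$. Fix a number of layers $L$, a transformation $\mathcal T$ from $\mathcal G$ to the $d$-featured graphs, a selection function $\mathcal V$ choosing a set $\mathcal V(x)\subseteq V(\mathcal T(G))$ for each $x=(G,u)\in\mathcal X$, and a pooling function $\Psi$, which maps each family of vectors $(h(v))_{v\in\mathcal V(x)}$ to a vector. *Networks.* An MPNN with $L$ layers computes $h^{(0)}_G=a_G$ and $h^{(t)}_G(v)=\varphi_t\big(W^{(1)}_th^{(t-1)}_G(v)+W^{(2)}_t\sum_{u\in N(v)}h^{(t-1)}_G(u)\big)$ for $t=1,\dots,L$. The corresponding $(\mathcal T,\mathcal V,\Psi)$-MPNN maps $x=(G,u)$ to $\Psi$ of the family $(h^{(L)}_{\mathcal T(G)}(v))_{v\in\mathcal V(x)}$; call this output $h(x)$. Then $\Psi$ is *sub-sum*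 for this network if there is $c>0$ such that for all $x_1=(G_1,u_1)$, $x_2=(G_2,u_2)$ in $\mathcal X$, $$\|h(x_1)-h(x_2)\|_2\le c\sum_{v\in\mathcal V(x_1)}\big\|h^{(L)}_{\mathcal T(G_1)}(v)-h^{(L)}_{\mathcal T(G_2)}(\sigma(v))\big\|_2$$ in the following two cases: $|\mathcal V(x_1)|>|\mathcal V(x_2)|$ and $\sigma$ is any surjection $\mathcal V(x_1)\to\mathcal V(x_2)\cup\{*\}$ that is injective away from the fibre of $*$, where $h^{(L)}_{\mathcal T(G_2)}(*):=0$; or $|\mathcal V(x_1)|=|\mathcal V(x_2)|$ and $\sigma$ is any bijection $\mathcal V(x_1)\to\mathcal V(x_2)$. *Unrolling distance.* The unrolling tree of depth $0$ of a node $u$ is a single root with feature $a_G(u)$; that of depth $L>0$ is a root with feature $a_G(u)$ to which, for every neighbour $v$ of $u$, the unrolling tree of depth $L-1$ of $v$ is attached. For $x_1,x_2\in\mathcal X$ with $x_i=(G_i,u_i)$, take the depth-$L$ unrolling trees in $\mathcal T(G_i)$ of all nodes of $\mathcal V(x_i)$. Let $q$ and $D$ be the maximal number of children of a node and the maximal depth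 over all these trees for $i=1,2$. Pad all trees, by nodes with feature $0$, to rooted trees of depth $D$ in which each non-leaf node has exactly $q$ children, and pad the smaller of the two multisets by such trees with all features $0$ until both have the same size. This yields two forests $F_1,F_2$ of the same shape. Then $\mathrm{UD}^{(L)}_{\mathcal T,\mathcal V}(x_1,x_2)=\min_\phi\sum_{y\in V(F_1)}\|a_{F_1}(y)-a_{F_2}(\phi(y))\|_2$, over all bijections $\phi:V(F_1)\to V(F_2)$ that preserve the edges directed away from the roots. On $\mathcal Z$ let $d_\infty((x,y),(x',y'))=\max\{\mathrm{UD}^{(L)}_{\mathcal T,\mathcal V}(x,x'),\delta(y,y')\}$ with $\delta(y,y')=0$ if $y=y'$ and $\infty$ otherwise. For $\varepsilon>0$ let $K_\varepsilon\in\mathbb N\cup\{\infty\}$ be the least cardinality of a set $S\subseteq\mathcal X$ such that each $x\in\mathcal X$ has some $y\in S$ with $\mathrm{UD}^{(L)}_{\mathcal T,\mathcal V}(x,y)\le\varepsilon$. *Learning.* Let $\mathcal H$ be a class of $(\mathcal T,\mathcal V,\Psi)$-MPNNs with $L$ layers, for each of which $\Psi$ is sub-sum, where $\varphi_t$ is $L_{\varphi_t}$-Lipschitz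 for the 2-norm and all matrices have 2-norm at most $B$. Let $\mathcal X$ carry a $\sigma$-algebra for which $x\mapsto\mathrm{UD}^{(L)}_{\mathcal T,\mathcal V}(x,x')$ is measurable for all $x'$ (for instance the power set), and $\mathcal Z$ the product $\sigma$-algebra. Let $\ell:\mathcal H\times\mathcal Z\to[0,M]$ be a loss such that each $\ell(h,\cdot)$ is measurable and $L_\ell$-Lipschitz with respect to $d_\infty$. Let $\mathcal S=(Z_1,\dots,Z_N)$, $N\ge1$, be $\mathcal Z$-valued random variables on a probability space $(\Omega,P)$, each with law $\mu$, and let $\mathcal A$ be a learning algorithm, that is, any map $\mathcal Z^N\to\mathcal H$. Put $\ell_{\exp}(h)=\int\ell(h,z)\,d\mu(z)$, $\ell_{\mathrm{emp}}(h)=\frac1N\sum_{i=1}^N\ell(h,Z_i)$, and let $D_{\mathcal S}=\max_{G\in\mathcal G}|\{i\mid Z_i\text{ is a node of }G\text{ with a label}\}|$. *Assumption (A).* Samples from different graphs are independent, while samples from the same graph may be dependent. Precisely: the families $(Z_i)_{i\in I}$ and $(Z_j)_{j\in J}$ are independent for all disjoint $I,J\subseteq\{1,\dots,N\}$ such that for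 no $i\in I$, $j\in J$ the samples $Z_i,Z_j$ come almost surely from the same graph. **Theorem.** There is a constant $C=C(L,L_\ell,(L_{\varphi_t})_{t\le L})\ge0$, depending only on $L$, $L_\ell$ and the $L_{\varphi_t}$, such that in the above setting, under assumption (A), for each $\delta>0$ there is an event of probability at least $1-\delta$ on which $$\left|\ell_{\exp}(\mathcal A_{\mathcal S})-\ell_{\mathrm{emp}}(\mathcal A_{\mathcal S})\right|\le2C\varepsilon+M\sqrt{\frac{2D_{\mathcal S}\big((2K_\varepsilon+1)\log2+\log\frac1\delta\big)}{N}}\qquad\text{for all }\varepsilon>0\text{ with }K_\varepsilon<\infty .$$ -/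

import Mathlib

open MeasureTheory ProbabilityTheory
open scoped NNReal ENNReal

noncomputable section

namespace NodeGen

/-- The feature space `ℝ^d` with the Euclidean norm. -/
abbrev Vec (d : ℕ) : Type := EuclideanSpace ℝ (Fin d)

/-- A finite undirected simple graph with node set `{0, …, order - 1}` and node features in `ℝ^d`. -/
structure FeatGraph (d : ℕ) where
  order : ℕ
  graph : SimpleGraph (Fin order)
  feat : Fin order → Vec d

open Classical in
/-- The neighbours of a node. -/
def FeatGraph.nbrs {d : ℕ} (G : FeatGraph d) (u : Fin G.order) : Finset (Fin G.order) :=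
  Finset.univ.filter fun v => G.graph.Adj u v

/-- The node-representation task `𝒢 ⊗ V`: pairs of a graph in `𝒢` and one of its nodes. -/
structure NodeInput {d : ℕ} (𝒢 : Set (FeatGraph d)) where
  graph : 𝒢
  node : Fin graph.1.order

/-- Labelled examples, that is, `(𝒢 ⊗ V) × {0,1}`. -/
abbrev Example {d : ℕ} (𝒢 : Set (FeatGraph d)) : Type := NodeInput 𝒢 × Fin 2

/-- Transformation functions `𝒯`. -/
abbrev Transformation {d : ℕ} (𝒢 : Set (FeatGraph d)) : Type := 𝒢 → FeatGraph d

/-- Selection functions `𝒱`: they choose a set of nodes of the transformed graph. -/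
abbrev Selection {d : ℕ} {𝒢 : Set (FeatGraph d)} (T : Transformation 𝒢) : Type :=
  (x : NodeInput 𝒢) → Finset (Fin (T x.graph).order)

/-- Pooling functions `Ψ`: for every input they turn the vectors at the selected nodes (each vector
is given together with its node, that is, as a family indexed by the nodes) into one vector. -/
abbrev Pooling {d : ℕ} {𝒢 : Set (FeatGraph d)} {T : Transformation 𝒢} (V : Selection T)
    (e p : ℕ) : Type :=
  (x : NodeInput 𝒢) → (V x → Vec e) → Vec p

/-! ### Message-passing neural networks with sum aggregation -/

/-- `MPNN d L e` is the type of MPNNs with `L` layers, input dimension `d` and output dimension `e`.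
A layer is given by two matrices (written as linear maps) and a map `φ`. -/
inductive MPNN (d : ℕ) : ℕ → ℕ → Type
  | input : MPNN d 0 d
  | layer {L e k e' : ℕ} (net : MPNN d L e) (W₁ W₂ : Vec e →L[ℝ] Vec k) (φ : Vec k → Vec e') :
      MPNN d (L + 1) e'

/-- The vector that the network computes at the node `v`: the feature of `v` for the network without
layers, and `φ (W₁ h(v) + W₂ ∑_{u ∈ N(v)} h(u))` after one more layer. -/
def MPNN.hidden {d : ℕ} (G : FeatGraph d) : {L e : ℕ} → MPNN d L e → Fin G.order → Vec e
  | _, _, .input, v => G.feat v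
  | _, _, .layer net W₁ W₂ φ, v =>
      φ (W₁ (net.hidden G v) + W₂ (∑ u ∈ G.nbrs v, net.hidden G u))

/-- The map `φ` of layer `t` is `Lφ t`-Lipschitz for the 2-norm, and all matrices have 2-norm (operator
norm) at most `B`. -/
def MPNN.HasBounds {d : ℕ} (B : ℝ) : {L e : ℕ} → MPNN d L e → (Fin L → ℝ≥0) → Prop
  | _, _, .input, _ => True
  | _, _, .layer (L := L) net W₁ W₂ φ, Lφ =>
      net.HasBounds B (fun t => Lφ t.castSucc) ∧
        LipschitzWith (Lφ (Fin.last L)) φ ∧ ‖W₁‖ ≤ B ∧ ‖W₂‖ ≤ B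

section Generalized

variable {d : ℕ} {𝒢 : Set (FeatGraph d)} {T : Transformation 𝒢} {V : Selection T} {L e p : ℕ}

/-- The final representation computed by the generalized `(𝒯, 𝒱, Ψ)`-MPNN. -/
def MPNN.output (net : MPNN d L e) (Ψ : Pooling V e p) (x : NodeInput 𝒢) : Vec p :=
  Ψ x fun v => net.hidden (T x.graph) v

/-- The sub-sum property of the pooling function of a generalized MPNN. The extra point `*` is `none`,
and the representation of `*` is the zero vector. -/
def SubSum (Ψ : Pooling V e p) (net : MPNN d L e) : Prop :=
  ∃ c : ℝ, 0 < c ∧ ∀ x₁ x₂ : NodeInput 𝒢,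
    ((V x₂).card < (V x₁).card → ∀ σ : V x₁ → Option (V x₂), Function.Surjective σ →
      (∀ u v, u ≠ v → σ u = σ v → σ u = none) →
      ‖net.output Ψ x₁ - net.output Ψ x₂‖ ≤
        c * ∑ v : V x₁, ‖net.hidden (T x₁.graph) v -
          (σ v).elim 0 fun w => net.hidden (T x₂.graph) w‖) ∧
    ((V x₁).card = (V x₂).card → ∀ σ : V x₁ → V x₂, Function.Bijective σ →
      ‖net.output Ψ x₁ - net.output Ψ x₂‖ ≤
        c * ∑ v : V x₁, ‖net.hidden (T x₁.graph) v - net.hidden (T x₂.graph) (σ v)‖)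

end Generalized

/-! ### Unrolling trees and the unrolling distance -/

/-- Finite rooted trees with node features in `ℝ^d`: a root feature and `k` subtrees. -/
inductive FTree (d : ℕ) : Type
  | node (a : Vec d) (k : ℕ) (child : Fin k → FTree d) : FTree d

/-- The unrolling tree of depth `L` of the node `u`. -/
def FeatGraph.unroll {d : ℕ} (G : FeatGraph d) : ℕ → Fin G.order → FTree d
  | 0, u => .node (G.feat u) 0 Fin.elim0
  | L + 1, u => .node (G.feat u) (G.nbrs u).card
      fun i => G.unroll L ((G.nbrs u).orderEmbOfFin rfl i)

/-- The largest number of children of a node of the tree. -/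
def FTree.maxOut {d : ℕ} : FTree d → ℕ
  | .node _ k child => max k (Finset.univ.sup fun i => (child i).maxOut)

/-- The depth of the tree. -/
def FTree.depth {d : ℕ} : FTree d → ℕ
  | .node _ _ child => Finset.univ.sup fun i => (child i).depth + 1

/-- The feature at the node with the given address (a list of child indices, from the root
downwards); it is zero when the tree has no such node, that is, at the nodes added by padding. -/
def FTree.label {d : ℕ} : FTree d → List ℕ → Vec d
  | .node a _ _, [] => a
  | .node _ k child, c :: w => if h : c < k then (child ⟨c, h⟩).label w else 0

/-- The nodes of a forest of `m` rooted trees of depth `D` all of whose non-leaf nodes have exactly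
`q` children: the number of a tree and a word of length at most `D` over `{0, …, q - 1}`. -/
abbrev PadNode (m q D : ℕ) : Type := Fin m × (Σ k : Fin (D + 1), Fin (k : ℕ) → Fin q)

/-- The word of a node of the padded forest. -/
def PadNode.address {m q D : ℕ} (x : PadNode m q D) : List ℕ :=
  List.ofFn fun j => (x.2.2 j : ℕ)

/-- The directed edges of the padded forest: `y` is a child of `x`. -/
def PadNode.IsChild {m q D : ℕ} (x y : PadNode m q D) : Prop :=
  x.1 = y.1 ∧ ∃ c : ℕ, PadNode.address y = PadNode.address x ++ [c]

section Forest

variable {d : ℕ} (L : ℕ) (G : FeatGraph d) (A : Finset (Fin G.order))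

/-- The largest number of children in the unrolling trees of the nodes in `A`. -/
def forestMaxOut : ℕ := A.sup fun u => (G.unroll L u).maxOut

/-- The largest depth of the unrolling trees of the nodes in `A`. -/
def forestDepth : ℕ := A.sup fun u => (G.unroll L u).depth

/-- The node features of the padded forest of the unrolling trees of the nodes in `A`: all added
nodes, including those of added trees, have the feature zero. -/
def forestFeat {m q D : ℕ} (x : PadNode m q D) : Vec d :=
  if h : (x.1 : ℕ) < A.card then
    (G.unroll L (A.orderEmbOfFin rfl ⟨x.1, h⟩)).label (PadNode.address x)
  else 0

end Forest

/-- The distance of the multisets of unrolling trees of `A₁` and `A₂`: both are padded to forests of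
the same shape, and the sum of feature distances is minimized over the bijections of the nodes that
preserve the edges (directed away from the roots). -/
def forestDist {d : ℕ} (L : ℕ) (G₁ : FeatGraph d) (A₁ : Finset (Fin G₁.order))
    (G₂ : FeatGraph d) (A₂ : Finset (Fin G₂.order)) : ℝ :=
  let m := max A₁.card A₂.card
  let q := max (forestMaxOut L G₁ A₁) (forestMaxOut L G₂ A₂)
  let D := max (forestDepth L G₁ A₁) (forestDepth L G₂ A₂)
  ⨅ φ : (PadNode.IsChild (m := m) (q := q) (D := D)) ≃r
      (PadNode.IsChild (m := m) (q := q) (D := D)),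
    ∑ x : PadNode m q D, ‖forestFeat L G₁ A₁ x - forestFeat L G₂ A₂ (φ x)‖

section Learning

variable {d : ℕ} {𝒢 : Set (FeatGraph d)}

/-- The `(𝒯, 𝒱)`-unrolling distance of depth `L`. -/
def UD {T : Transformation 𝒢} (V : Selection T) (L : ℕ) (x x' : NodeInput 𝒢) : ℝ :=
  forestDist L (T x.graph) (V x) (T x'.graph) (V x')

/-- The distance `d_∞` on labelled examples: the maximum of the unrolling distance and the discrete
metric on the labels with values `0` and `∞`. -/
def dInf {T : Transformation 𝒢} (V : Selection T) (L : ℕ) (z z' : Example 𝒢) : ℝ≥0∞ :=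
  max (ENNReal.ofReal (UD V L z.1 z'.1)) (if z.2 = z'.2 then 0 else ⊤)

/-- The covering number: the least cardinality of a finite `ε`-cover, `⊤` if there is none. -/
def coveringNumber {X : Type*} (dist : X → X → ℝ) (ε : ℝ) : ℕ∞ :=
  ⨅ (S : Finset X) (_ : ∀ x, ∃ y ∈ S, dist x y ≤ ε), (S.card : ℕ∞)

/-- The largest number of examples of the sample that come from one and the same graph. -/
def maxPerGraph {N : ℕ} (S : Fin N → Example 𝒢) : ℕ :=
  ⨆ G : 𝒢, Nat.card {i : Fin N // (S i).1.graph = G}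

/-- `Γ` is a dependency graph of the random variables `Z i`: for disjoint sets `I`, `J` of indices
without an edge between them, the families `(Z i)_{i ∈ I}` and `(Z j)_{j ∈ J}` are independent. -/
def IsDependencyGraph {Ω E ι : Type*} [MeasurableSpace Ω] [MeasurableSpace E]
    (P : Measure Ω) (Γ : SimpleGraph ι) (Z : ι → Ω → E) : Prop :=
  ∀ I J : Set ι, Disjoint I J → (∀ i ∈ I, ∀ j ∈ J, ¬ Γ.Adj i j) →
    IndepFun (fun ω (i : I) => Z i ω) (fun ω (j : J) => Z j ω) P

/-- The graph on the indices of a random sample that joins two examples when they come from the same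
graph (almost surely). -/
def sameGraph {Ω : Type*} [MeasurableSpace Ω] (P : Measure Ω) {N : ℕ}
    (Z : Fin N → Ω → Example 𝒢) : SimpleGraph (Fin N) where
  Adj i j := i ≠ j ∧ ∀ᵐ ω ∂P, (Z i ω).1.graph = (Z j ω).1.graph
  symm := ⟨fun _ _ h => ⟨h.1.symm, h.2.mono fun _ hω => hω.symm⟩⟩
  loopless := ⟨fun _ h => h.1 rfl⟩

/-- Assumption (A): examples that come from different graphs are independent, while examples that
come from the same graph may be dependent. -/
def AssumptionA {Ω : Type*} [MeasurableSpace Ω] [MeasurableSpace (NodeInput 𝒢)] (P : Measure Ω)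
    {N : ℕ} (Z : Fin N → Ω → Example 𝒢) : Prop :=
  IsDependencyGraph P (sameGraph P Z) Z

/-- Expected risk. -/
def expRisk {X : Type*} [MeasurableSpace X] (μ : Measure X) (loss : X → ℝ) : ℝ := ∫ z, loss z ∂μ

/-- Empirical risk. -/
def empRisk {X : Type*} {N : ℕ} (S : Fin N → X) (loss : X → ℝ) : ℝ :=
  (1 / (N : ℝ)) * ∑ i, loss (S i)

end Learning

end NodeGen

end

open NodeGen

/-! The argument is robustness plus concentration. A cover of the inputs by `K` balls of radius `ε`,
refined to disjoint measurable cells and crossed with the two labels, splits the examples into `2K`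
cells. By the Lipschitz condition every loss stays within `Lℓ * ε` of its value at a cell
representative, which costs `2 * Lℓ * ε` over the expected and the empirical risk. The remaining
error involves only cell frequencies. It is at most `M * t` as soon as each of the `2 ^ (2K)` unions
of cells has a frequency within `t` of its probability (`abs_integral_comp_sub_mean_le`). This event
does not mention the hypothesis, so the algorithm may be arbitrary.

Each frequency obeys a Hoeffding bound (`measureReal_frequency_deviation_le`). Having almost surely
the same graph is an equivalence relation on the indices; its classes are independent blocks, and
with largest block size `m` the exponent is `2 * N * t ^ 2 / m`. Almost surely `m` is at most the
random number `maxPerGraph`.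

For uniformity in `ε`, the failure events with a fixed `K` grow as `ε` decreases, so their union
obeys the same bound (`measure_exists_lt_le`). The budgets `δ / 2 / 2 ^ K` then sum to `δ` over all
`K`. -/

namespace NodeGen

/-! ### Concentration for samples with independent blocks -/

section Concentration

variable {Ω E ι κ : Type*} [MeasurableSpace Ω] [MeasurableSpace E] [Fintype ι]
  {P : Measure Ω} [IsProbabilityMeasure P]

open Classical in
/-- A sum of bounded centred variables whose blocks (the fibres of `f`) are independent is
sub-Gaussian, the variance proxy of a block being a quarter of its squared size. -/
theorem hasSubgaussianMGF_sum_blocks {Z : ι → Ω → E} (f : ι → κ)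
    (hZ : ∀ i, Measurable (Z i))
    (hind : ∀ I J : Set ι, (∀ i ∈ I, ∀ j ∈ J, f i ≠ f j) →
      IndepFun (fun ω (i : I) => Z i ω) (fun ω (j : J) => Z j ω) P)
    {g : E → ℝ} (hg : Measurable g) {a : ℝ} (hab : ∀ z, g z ∈ Set.Icc a (a + 1))
    (hmean : ∀ i, ∫ ω, g (Z i ω) ∂P = 0) (T : Finset κ) :
    HasSubgaussianMGF (fun ω => ∑ i with f i ∈ T, g (Z i ω))
      (∑ k ∈ T, (((Finset.univ.filter fun i => f i = k).card : ℝ≥0) / 2) ^ 2) P := by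
  have hsum (s : Finset ι) :
      Measurable fun t : ↥(s : Set ι) → E => ∑ i ∈ s.attach, g (t ⟨i.1, i.2⟩) :=
    Finset.measurable_sum _ fun i _ => hg.comp (measurable_pi_apply _)
  induction T using Finset.induction_on with
  | empty => simp
  | insert k T hk ih =>
    have hsplit (ω : Ω) : ∑ i with f i ∈ insert k T, g (Z i ω) =
        (∑ i with f i = k, g (Z i ω)) + ∑ i with f i ∈ T, g (Z i ω) := by
      rw [← Finset.sum_union]
      · congr 1
        ext i
        simp
      · rw [Finset.disjoint_filter]
        rintro i - rfl
        exact hk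
    simp_rw [hsplit]
    rw [Finset.sum_insert hk]
    refine HasSubgaussianMGF.add_of_indepFun ?_ ih ?_
    · set s : Finset ι := Finset.univ.filter fun i => f i = k with hs
      have hb (ω : Ω) : ∑ i ∈ s, g (Z i ω) ∈ Set.Icc (s.card * a) (s.card * (a + 1)) := by
        constructor
        · simpa using Finset.card_nsmul_le_sum s _ a fun i _ => (hab (Z i ω)).1
        · simpa [mul_add] using Finset.sum_le_card_nsmul s (fun i => g (Z i ω)) _ fun i _ => (hab (Z i ω)).2
      -- Hoeffding's lemma for the whole block: only the length of the range enters, so dependence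
      -- inside the block is harmless.
      have := hasSubgaussianMGF_of_mem_Icc_of_integral_eq_zero (μ := P)
        (Finset.measurable_sum s fun i _ => hg.comp (hZ i)).aemeasurable
        (ae_of_all _ hb) (by
          simp only [Function.comp_apply]
          rw [integral_finsetSum]
          · exact Finset.sum_eq_zero fun i _ => hmean i
          · exact fun i _ => Integrable.of_mem_Icc a (a + 1) (hg.comp (hZ i)).aemeasurable
              (ae_of_all _ fun ω => hab _))
      have hnorm : ‖(s.card : ℝ) * (a + 1) - s.card * a‖₊ = s.card := by
        ext
        simp [mul_add]
      rw [hnorm] at this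
      exact this
    · have := (hind (Finset.univ.filter fun i => f i = k : Finset ι)
        (Finset.univ.filter fun i => f i ∈ T : Finset ι) (by
          intro i hi j hj hij
          simp only [Finset.coe_filter, Finset.mem_univ, true_and, Set.mem_ofPred_eq] at hi hj
          exact hk (hi ▸ hij ▸ hj))).comp (hsum _) (hsum _)
      convert this using 1 <;>
      · ext ω
        exact (Finset.sum_attach _ fun i => g (Z i ω)).symm

open Classical in
/-- Hoeffding's inequality for the empirical frequency of an event in a sample whose blocks
(the fibres of `f`) are independent and have size at most `m`. -/
theorem measureReal_frequency_deviation_le [Nonempty ι] {Z : ι → Ω → E} (f : ι → κ)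
    (hZ : ∀ i, Measurable (Z i))
    (hind : ∀ I J : Set ι, (∀ i ∈ I, ∀ j ∈ J, f i ≠ f j) →
      IndepFun (fun ω (i : I) => Z i ω) (fun ω (j : J) => Z j ω) P)
    {μ : Measure E} (hμ : ∀ i, P.map (Z i) = μ) {m : ℕ}
    (hm : ∀ i, (Finset.univ.filter fun j => f j = f i).card ≤ m)
    {A : Set E} (hA : MeasurableSet A) {t : ℝ} (ht : 0 ≤ t) :
    P.real {ω | t ≤ |μ.real A - (Finset.univ.filter fun i => Z i ω ∈ A).card / Fintype.card ι|} ≤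
      2 * Real.exp (-(2 * Fintype.card ι * t ^ 2 / m)) := by
  set n : ℝ := (Fintype.card ι : ℝ) with hn
  have hn0 : 0 < n := by rw [hn]; exact_mod_cast Fintype.card_pos
  obtain ⟨i₀⟩ := ‹Nonempty ι›
  have hμp : IsProbabilityMeasure μ := by
    rw [← hμ i₀]; exact Measure.isProbabilityMeasure_map (hZ i₀).aemeasurable
  have hm0 : 0 < m := lt_of_lt_of_le (Finset.card_pos.2 ⟨i₀, by simp⟩) (hm i₀)
  set g : E → ℝ := fun z => A.indicator 1 z - μ.real A with hgdef
  have hg : Measurable g := (measurable_one.indicator hA).sub_const _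
  have hab (z : E) : g z ∈ Set.Icc (-μ.real A) (-μ.real A + 1) := by
    by_cases hz : z ∈ A <;> simp [hgdef, hz]
  have hmean (i : ι) : ∫ ω, g (Z i ω) ∂P = 0 := by
    rw [← integral_map (hZ i).aemeasurable hg.aestronglyMeasurable, hμ i, hgdef,
      integral_sub ((integrable_const 1).indicator hA) (integrable_const _)]
    simp [integral_indicator_one hA]
  have hsub := hasSubgaussianMGF_sum_blocks f hZ hind hg hab hmean (Finset.univ.image f)
  set c : ℝ≥0 := ∑ k ∈ Finset.univ.image f,
    (((Finset.univ.filter fun i => f i = k).card : ℝ≥0) / 2) ^ 2 with hc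
  -- A block of size `b ≤ m` contributes `b ^ 2 / 4 ≤ m * b / 4`, and the block sizes add up to `n`.
  have hcle : (c : ℝ) ≤ m * n / 4 := by
    have h1 : (c : ℝ) ≤ ∑ k ∈ Finset.univ.image f,
        (m / 4 : ℝ) * (Finset.univ.filter fun i => f i = k).card := by
      rw [hc]
      push_cast
      refine Finset.sum_le_sum fun k hk => ?_
      obtain ⟨i, -, rfl⟩ := Finset.mem_image.1 hk
      have : ((Finset.univ.filter fun j => f j = f i).card : ℝ) ≤ m := by exact_mod_cast hm i
      have h0 : (0 : ℝ) ≤ (Finset.univ.filter fun j => f j = f i).card := by positivity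
      nlinarith
    refine h1.trans (le_of_eq ?_)
    rw [← Finset.mul_sum, ← Nat.cast_sum, ← Finset.card_eq_sum_card_image, Finset.card_univ]
    ring
  have hc0 : (0 : ℝ) < c := by
    rw [hc]
    push_cast
    refine Finset.sum_pos (fun k hk => ?_) ⟨f i₀, by simp⟩
    obtain ⟨i, -, rfl⟩ := Finset.mem_image.1 hk
    have : 0 < (Finset.univ.filter fun j => f j = f i).card := Finset.card_pos.2 ⟨i, by simp⟩
    positivity
  clear_value c
  have hm0' : (0 : ℝ) < m := Nat.cast_pos.2 hm0
  have hexp : Real.exp (-(n * t) ^ 2 / (2 * c)) ≤ Real.exp (-(2 * n * t ^ 2 / m)) := by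
    refine Real.exp_le_exp.2 ?_
    rw [neg_div]
    refine neg_le_neg ?_
    rw [div_le_div_iff₀ hm0' (mul_pos two_pos hc0)]
    nlinarith [mul_le_mul_of_nonneg_left hcle (by positivity : 0 ≤ n * t ^ 2)]
  have hall (ω : Ω) : ∑ i with f i ∈ Finset.univ.image f, g (Z i ω) =
      (Finset.univ.filter fun i => Z i ω ∈ A).card - n * μ.real A := by
    rw [Finset.filter_true_of_mem fun i _ => Finset.mem_image_of_mem f (Finset.mem_univ i)]
    simp only [hgdef, Finset.sum_sub_distrib, Set.indicator_apply, Pi.one_apply,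
      Finset.sum_boole, Finset.sum_const, Finset.card_univ, nsmul_eq_mul, hn]
  have hsubset : {ω | t ≤ |μ.real A - (Finset.univ.filter fun i => Z i ω ∈ A).card / n|} ⊆
      {ω | n * t ≤ ∑ i with f i ∈ Finset.univ.image f, g (Z i ω)} ∪
      {ω | n * t ≤ (-fun ω => ∑ i with f i ∈ Finset.univ.image f, g (Z i ω)) ω} := by
    intro ω hω
    simp only [Set.mem_union, Set.mem_ofPred_eq, Pi.neg_apply, hall] at hω ⊢
    set r : ℝ := ((Finset.univ.filter fun i => Z i ω ∈ A).card : ℝ)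
    have hr : r = n * (r / n) := by field_simp
    rcases le_abs.1 hω with h | h
    · right; rw [hr]; nlinarith
    · left; rw [hr]; nlinarith
  calc _ ≤ _ := measureReal_mono hsubset
    _ ≤ _ := measureReal_union_le _ _
    _ ≤ Real.exp (-(n * t) ^ 2 / (2 * c)) + Real.exp (-(n * t) ^ 2 / (2 * c)) :=
      add_le_add (hsub.measure_ge_le (by positivity)) (hsub.neg.measure_ge_le (by positivity))
    _ ≤ _ := by linarith

end Concentration

/-! ### From cell frequencies to the generalization gap -/

open Classical in
/-- If the frequencies of all unions of cells are within `t` of their probabilities, then so are,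
up to the factor `M`, the means of all functions that are constant on cells with values in
`[0, M]`. -/
theorem abs_integral_comp_sub_mean_le {E ι κ : Type*} [MeasurableSpace E] [Fintype ι] [Fintype κ]
    [MeasurableSpace κ] [MeasurableSingletonClass κ] {μ : Measure E} [IsProbabilityMeasure μ]
    {q : E → κ} (hq : Measurable q) {G : κ → ℝ} {M t : ℝ} (hM : 0 ≤ M)
    (hG : ∀ k, 0 ≤ G k ∧ G k ≤ M) (z : ι → E)
    (h : ∀ A : Finset κ, |μ.real (q ⁻¹' A) -
      (Finset.univ.filter fun i => z i ∈ q ⁻¹' A).card / Fintype.card ι| ≤ t) :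
    |∫ x, G (q x) ∂μ - (1 / (Fintype.card ι : ℝ)) * ∑ i, G (q (z i))| ≤ M * t := by
  set e : κ → ℝ := fun k => μ.real (q ⁻¹' {k}) -
    (Finset.univ.filter fun i => q (z i) = k).card / Fintype.card ι with he
  have hint : ∫ x, G (q x) ∂μ = ∑ k, G k * μ.real (q ⁻¹' {k}) := by
    have : IsProbabilityMeasure (μ.map q) := Measure.isProbabilityMeasure_map hq.aemeasurable
    have hGm : Measurable G := measurable_of_finite G
    rw [← integral_map hq.aemeasurable hGm.aestronglyMeasurable, integral_fintype .of_finite]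
    refine Finset.sum_congr rfl fun k _ => ?_
    rw [smul_eq_mul, mul_comm, map_measureReal_apply hq (measurableSet_singleton k)]
  have hemp : ∑ i, G (q (z i)) = ∑ k, G k * (Finset.univ.filter fun i => q (z i) = k).card := by
    rw [← Finset.sum_fiberwise Finset.univ (fun i => q (z i))]
    refine Finset.sum_congr rfl fun k _ => ?_
    rw [Finset.sum_congr rfl (g := fun _ => G k) fun i hi => by rw [(Finset.mem_filter.1 hi).2]]
    simp [mul_comm]
  have hdiff : ∫ x, G (q x) ∂μ - (1 / (Fintype.card ι : ℝ)) * ∑ i, G (q (z i)) =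
      ∑ k, G k * e k := by
    rw [hint, hemp, Finset.mul_sum, ← Finset.sum_sub_distrib]
    refine Finset.sum_congr rfl fun k _ => ?_
    rw [he]
    ring
  have hA (A : Finset κ) : |∑ k ∈ A, e k| ≤ t := by
    convert h A using 2
    have h1 : ∑ k ∈ A, μ.real (q ⁻¹' {k}) = μ.real (q ⁻¹' A) :=
      sum_measureReal_preimage_singleton A fun k _ => hq (measurableSet_singleton k)
    have h2 : ∑ k ∈ A, (Finset.univ.filter fun i => q (z i) = k).card =
        (Finset.univ.filter fun i => z i ∈ q ⁻¹' A).card := by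
      rw [Finset.card_eq_sum_card_fiberwise (f := fun i => q (z i)) (t := A) (by intro i; simp)]
      refine Finset.sum_congr rfl fun k hk => ?_
      congr 1
      ext i
      simp only [Finset.mem_filter, Finset.mem_univ, true_and, Set.mem_preimage, Finset.mem_coe]
      exact ⟨fun hi => ⟨hi ▸ hk, hi⟩, fun hi => hi.2⟩
    rw [he, Finset.sum_sub_distrib, h1, ← Finset.sum_div, ← Nat.cast_sum, h2]
  -- Since `0 ≤ G ≤ M`, negative terms can be dropped and `G` replaced by `M` in the others; what
  -- remains is the error of a single union of cells. Using this for `e` and `-e` gives the factor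
  -- `M`.
  have hup (u : κ → ℝ) : ∑ k, G k * u k ≤ M * ∑ k with 0 ≤ u k, u k := by
    rw [Finset.mul_sum, Finset.sum_filter]
    refine Finset.sum_le_sum fun k _ => ?_
    split_ifs with hk
    · exact mul_le_mul_of_nonneg_right (hG k).2 hk
    · exact mul_nonpos_of_nonneg_of_nonpos (hG k).1 (not_le.1 hk).le
  rw [hdiff, abs_le']
  constructor
  · exact (hup e).trans (mul_le_mul_of_nonneg_left ((le_abs_self _).trans (hA _)) hM)
  · have := hup fun k => -e k
    simp only [mul_neg, Finset.sum_neg_distrib] at this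
    refine this.trans ?_
    rw [← mul_neg]
    exact mul_le_mul_of_nonneg_left ((neg_le_abs _).trans (hA _)) hM

open Classical in
/-- Robust learning algorithms generalize: if the losses vary by at most `η` from a
representative of each of finitely many cells, then the generalization gap of any algorithm exceeds
`2 * η + M * t` with small probability. -/
theorem measure_generalization_gap_gt_le {Ω E κ' κ H : Type*} [MeasurableSpace Ω]
    [MeasurableSpace E] [Fintype κ] [MeasurableSpace κ] [MeasurableSingletonClass κ]
    {P : Measure Ω} [IsProbabilityMeasure P] {N : ℕ} (hN : 0 < N) {Z : Fin N → Ω → E}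
    (f : Fin N → κ') (hZ : ∀ i, Measurable (Z i))
    (hind : ∀ I J : Set (Fin N), (∀ i ∈ I, ∀ j ∈ J, f i ≠ f j) →
      IndepFun (fun ω (i : I) => Z i ω) (fun ω (j : J) => Z j ω) P)
    {μ : Measure E} (hμ : ∀ i, P.map (Z i) = μ) {m : ℕ}
    (hm : ∀ i, (Finset.univ.filter fun j => f j = f i).card ≤ m)
    {q : E → κ} (hq : Measurable q) (y : κ → E) {ℓ : H → E → ℝ} {M η t : ℝ}
    (hℓm : ∀ h, Measurable (ℓ h)) (hℓ : ∀ h z, 0 ≤ ℓ h z ∧ ℓ h z ≤ M)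
    (hη : ∀ h z, |ℓ h z - ℓ h (y (q z))| ≤ η) (ht : 0 ≤ t) (𝒜 : Ω → H) :
    P {ω | 2 * η + M * t < |expRisk μ (ℓ (𝒜 ω)) - empRisk (fun i => Z i ω) (ℓ (𝒜 ω))|} ≤
      ENNReal.ofReal
        (2 ^ Fintype.card κ * (2 * Real.exp (-(2 * N * t ^ 2 / m)))) := by
  have : Nonempty (Fin N) := ⟨⟨0, hN⟩⟩
  have hμp : IsProbabilityMeasure μ := by
    rw [← hμ ⟨0, hN⟩]; exact Measure.isProbabilityMeasure_map (hZ _).aemeasurable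
  obtain ⟨ω₀⟩ := nonempty_of_isProbabilityMeasure P
  have hM : 0 ≤ M := (hℓ (𝒜 ω₀) (Z ⟨0, hN⟩ ω₀)).1.trans (hℓ (𝒜 ω₀) (Z ⟨0, hN⟩ ω₀)).2
  have hN' : (0 : ℝ) < N := Nat.cast_pos.2 hN
  set D : Finset κ → Set Ω := fun A => {ω | t ≤ |μ.real (q ⁻¹' A) -
    (Finset.univ.filter fun i => Z i ω ∈ q ⁻¹' A).card / N|} with hD
  have hsub : {ω | 2 * η + M * t <
      |expRisk μ (ℓ (𝒜 ω)) - empRisk (fun i => Z i ω) (ℓ (𝒜 ω))|} ⊆ ⋃ A, D A := by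
    intro ω hω
    by_contra hcon
    simp only [hD, Set.mem_iUnion, Set.mem_ofPred_eq, not_exists, not_le] at hcon hω
    -- The gap splits into three parts: `M * t` for the loss frozen at the representatives, and `η`
    -- each for freezing it in the expected and in the empirical risk.
    have hcell := abs_integral_comp_sub_mean_le hq (G := fun k => ℓ (𝒜 ω) (y k)) hM
      (fun k => hℓ _ _) (fun i => Z i ω) fun A => by
        rw [Fintype.card_fin]
        exact (hcon A).le
    rw [Fintype.card_fin] at hcell
    have hint {g : E → ℝ} (hg : Measurable g) (hgb : ∀ z, 0 ≤ g z ∧ g z ≤ M) :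
        Integrable g μ :=
      Integrable.of_mem_Icc 0 M hg.aemeasurable (ae_of_all _ hgb)
    have hexp : |expRisk μ (ℓ (𝒜 ω)) - ∫ x, ℓ (𝒜 ω) (y (q x)) ∂μ| ≤ η := by
      have hcm : Measurable fun x => ℓ (𝒜 ω) (y (q x)) :=
        (measurable_of_finite fun k => ℓ (𝒜 ω) (y k)).comp hq
      rw [expRisk, ← integral_sub (hint (hℓm (𝒜 ω)) (hℓ _)) (hint hcm fun z => hℓ _ _),
        ← Real.norm_eq_abs]
      have h := norm_integral_le_of_norm_le_const (μ := μ)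
        (f := fun z => ℓ (𝒜 ω) z - ℓ (𝒜 ω) (y (q z))) (ae_of_all _ fun z => hη (𝒜 ω) z)
      rwa [probReal_univ, mul_one] at h
    have hemp : |empRisk (fun i => Z i ω) (ℓ (𝒜 ω)) -
        (1 / (N : ℝ)) * ∑ i, ℓ (𝒜 ω) (y (q (Z i ω)))| ≤ η := by
      rw [empRisk, ← mul_sub, ← Finset.sum_sub_distrib, abs_mul, abs_of_pos (by positivity),
        one_div, inv_mul_le_iff₀ hN']
      refine (Finset.abs_sum_le_sum_abs _ _).trans ?_
      simpa using Finset.sum_le_card_nsmul Finset.univ _ η fun i _ => hη (𝒜 ω) (Z i ω)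
    rw [abs_le] at hcell hexp hemp
    refine absurd hω (not_lt.2 (abs_le.2 ⟨?_, ?_⟩)) <;> linarith
  refine (measure_mono hsub).trans ((measure_iUnion_fintype_le _ _).trans ?_)
  have hDle (A : Finset κ) :
      P (D A) ≤ ENNReal.ofReal (2 * Real.exp (-(2 * N * t ^ 2 / m))) := by
    rw [← ofReal_measureReal]
    refine ENNReal.ofReal_le_ofReal ?_
    have h := measureReal_frequency_deviation_le f hZ hind hμ hm (hq A.measurableSet) ht
    rw [Fintype.card_fin] at h
    exact h
  refine (Finset.sum_le_sum fun A _ => hDle A).trans (le_of_eq ?_)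
  rw [Finset.sum_const, Finset.card_univ, Fintype.card_finset, nsmul_eq_mul,
    ENNReal.ofReal_mul (p := 2 ^ Fintype.card κ) (by positivity)]
  congr 1
  rw [ENNReal.ofReal_pow (by norm_num)]
  simp

/-! ### Covers and measurable cells -/

theorem exists_cover_of_coveringNumber_eq {X : Type*} {dist : X → X → ℝ} {ε : ℝ} {K : ℕ}
    (h : coveringNumber dist ε = K) :
    ∃ S : Finset X, (∀ x, ∃ y ∈ S, dist x y ≤ ε) ∧ S.card = K := by
  by_contra! hcon
  have : ((K + 1 : ℕ) : ℕ∞) ≤ coveringNumber dist ε := by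
    refine le_iInf₂ fun S hS => ?_
    have hle : (K : ℕ∞) ≤ S.card := h ▸ iInf₂_le S hS
    have hne := hcon S hS
    norm_cast at hle ⊢
    omega
  rw [h] at this
  norm_cast at this
  omega

open Classical in
/-- The balls of a finite cover can be refined to a partition into measurable cells. -/
theorem exists_measurable_cells {X : Type*} [MeasurableSpace X] {dist : X → X → ℝ}
    (hd : ∀ c, Measurable fun x => dist x c) {ε : ℝ} (S : Finset X)
    (hS : ∀ x, ∃ y ∈ S, dist x y ≤ ε) :
    ∃ (c : X → Fin S.card) (y : Fin S.card → X), Measurable c ∧ ∀ x, dist x (y (c x)) ≤ ε := by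
  let y : Fin S.card → X := fun n => S.equivFin.symm n
  -- Each point goes to the first ball of the enumerated cover that contains it.
  let p : X → ℕ → Prop := fun x n => ∃ h : n < S.card, dist x (y ⟨n, h⟩) ≤ ε
  have hp (x : X) : ∃ n, p x n := by
    obtain ⟨s, hs, hxs⟩ := hS x
    exact ⟨S.equivFin ⟨s, hs⟩, Fin.is_lt _, by simpa [y] using hxs⟩
  have hpm (k : ℕ) : MeasurableSet {x | p x k} := by
    by_cases hk : k < S.card
    · simpa [p, hk] using measurableSet_le (hd (y ⟨k, hk⟩)) measurable_const
    · simp [p, hk]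
  refine ⟨fun x => ⟨Nat.find (hp x), (Nat.find_spec (hp x)).1⟩, y, ?_,
    fun x => (Nat.find_spec (hp x)).2⟩
  refine measurable_to_countable' fun k => ?_
  convert measurable_find hp hpm (measurableSet_singleton (k : ℕ)) using 1
  ext x
  simp [Fin.ext_iff]

/-! ### Threshold, block size and uniformity in the radius -/

/-- The threshold is chosen so that the failure probabilities sum up to `δ`. -/
theorem two_pow_mul_exp_threshold_le {N m K : ℕ} (hN : 0 < N) (hm : 0 < m) {δ : ℝ} (hδ : 0 < δ)
    (hδ1 : δ < 1) :
    2 ^ (K * 2) * (2 * Real.exp (-(2 * N *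
      √(2 * m * ((2 * K + 1) * Real.log 2 + Real.log (1 / δ)) / N) ^ 2 / m))) ≤ δ / 2 / 2 ^ K := by
  have hl : 0 < Real.log (1 / δ) := Real.log_pos (one_lt_one_div hδ hδ1)
  have h2 : 0 < Real.log 2 := Real.log_pos one_lt_two
  have hN' : (0 : ℝ) < N := Nat.cast_pos.2 hN
  have hm' : (0 : ℝ) < m := Nat.cast_pos.2 hm
  -- The exponent `3K + 2` is made of `2K` for the unions of cells, `1` for the two tails and `K +
  -- 1` for the target `δ / 2 / 2 ^ K`.
  have hexp : Real.exp (-(2 * N *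
      √(2 * m * ((2 * K + 1) * Real.log 2 + Real.log (1 / δ)) / N) ^ 2 / m)) ≤
      Real.exp (-((3 * K + 2 : ℕ) * Real.log 2 + Real.log (1 / δ))) := by
    rw [Real.sq_sqrt (by positivity), Real.exp_le_exp, neg_le_neg_iff]
    have : 2 * N * (2 * m * ((2 * K + 1) * Real.log 2 + Real.log (1 / δ)) / N) / m =
        4 * ((2 * K + 1) * Real.log 2 + Real.log (1 / δ)) := by
      field_simp
      ring
    rw [this]
    push_cast
    have : 0 ≤ (K : ℝ) * Real.log 2 := by positivity
    nlinarith
  have heq : Real.exp (-((3 * K + 2 : ℕ) * Real.log 2 + Real.log (1 / δ))) =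
      δ / 2 ^ (3 * K + 2) := by
    rw [neg_add, Real.exp_add, Real.exp_neg, Real.exp_nat_mul, Real.exp_log two_pos, Real.exp_neg,
      Real.exp_log (by positivity)]
    field_simp
  rw [heq] at hexp
  refine (mul_le_mul_of_nonneg_left (mul_le_mul_of_nonneg_left hexp two_pos.le)
    (by positivity)).trans (le_of_eq ?_)
  field_simp
  ring

open Classical in
/-- When dependent indices always share their graph, no block of dependent indices is larger than
the number of samples from one graph. -/
theorem exists_block_bound {d N : ℕ} {𝒢 : Set (FeatGraph d)} {κ : Type*} (hN : 0 < N)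
    (f : Fin N → κ) :
    ∃ m : ℕ, 0 < m ∧ (∀ i, (Finset.univ.filter fun j => f j = f i).card ≤ m) ∧
      ∀ S : Fin N → Example 𝒢, (∀ i j, f i = f j → (S i).1.graph = (S j).1.graph) →
        m ≤ maxPerGraph S := by
  obtain ⟨i, -, hi⟩ := Finset.exists_max_image Finset.univ
    (fun i => (Finset.univ.filter fun j => f j = f i).card) ⟨⟨0, hN⟩, Finset.mem_univ _⟩
  refine ⟨_, Finset.card_pos.2 ⟨i, by simp⟩, fun j => hi j (Finset.mem_univ j), fun S hS => ?_⟩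
  -- The class `𝒢` may be infinite, and an unbounded supremum in `ℕ` would be `0`.
  have hbdd : BddAbove (Set.range fun G : 𝒢 => Nat.card {i : Fin N // (S i).1.graph = G}) := by
    refine ⟨N, ?_⟩
    rintro _ ⟨G, rfl⟩
    simpa using Finite.card_subtype_le fun i => (S i).1.graph = G
  refine le_trans ?_ (le_ciSup hbdd (S i).1.graph)
  rw [Nat.card_eq_fintype_card, Fintype.card_subtype]
  refine Finset.card_le_card fun j hj => ?_
  simp only [Finset.mem_filter, Finset.mem_univ, true_and] at hj ⊢
  exact hS j i hj

/-- A uniform bound for the measures of the sets `{a * ε + b < g}` also holds for their union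
over all `ε`. -/
theorem measure_exists_lt_le {Ω : Type*} [MeasurableSpace Ω] {P : Measure Ω} {s : Set ℝ}
    {a b : ℝ} (ha : 0 ≤ a) {g : Ω → ℝ} {c : ℝ≥0∞}
    (h : ∀ ε ∈ s, P {ω | a * ε + b < g ω} ≤ c) :
    P {ω | ∃ ε ∈ s, a * ε + b < g ω} ≤ c := by
  -- Rational radii make the union countable, and monotonicity makes it directed, so its measure is
  -- the supremum of the measures.
  let R : Type := {r : ℚ // ∃ ε ∈ s, ε ≤ r}
  have hmono : Directed (· ⊆ ·) fun r : R => {ω | a * (r.1 : ℝ) + b < g ω} := by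
    have hanti : Antitone fun r : R => {ω | a * (r.1 : ℝ) + b < g ω} := by
      intro r r' hr ω hω
      have : ((r.1 : ℚ) : ℝ) ≤ (r'.1 : ℝ) := by exact_mod_cast hr
      exact lt_of_le_of_lt (add_le_add (mul_le_mul_of_nonneg_left this ha) le_rfl) hω
    exact hanti.directed_le
  have hsub : {ω | ∃ ε ∈ s, a * ε + b < g ω} ⊆ ⋃ r : R, {ω | a * (r.1 : ℝ) + b < g ω} := by
    rintro ω ⟨ε, hε, hω⟩
    -- Dividing by `a + 1` instead of `a` also covers `a = 0`.
    obtain ⟨r, hr, hr'⟩ := exists_rat_btwn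
      (show ε < ε + (g ω - (a * ε + b)) / (a + 1) from
        lt_add_of_pos_right _ (div_pos (sub_pos.2 hω) (by linarith)))
    refine Set.mem_iUnion.2 ⟨⟨r, ε, hε, hr.le⟩, ?_⟩
    have h1 : (r - ε) * (a + 1) < g ω - (a * ε + b) := by
      rw [← lt_div_iff₀ (by linarith)]
      linarith
    simp only [Set.mem_ofPred_eq]
    nlinarith
  refine (measure_mono hsub).trans ?_
  rw [hmono.measure_iUnion]
  refine iSup_le ?_
  rintro ⟨r, ε, hε, hr⟩
  refine (measure_mono fun ω hω => ?_).trans (h ε hε)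
  exact lt_of_le_of_lt (add_le_add (mul_le_mul_of_nonneg_left hr ha) le_rfl) hω

end NodeGen

/-! ### The generalization bound -/

open NodeGen
theorem mainTheorem3 :
    ∃ C : (L : ℕ) → (Lℓ : ℝ≥0) → (Lφ : Fin L → ℝ≥0) → ℝ≥0,
    -- the generalized MPNNs: graph class, transformation, selection, pooling
    ∀ {d L e p : ℕ} (𝒢 : Set (FeatGraph d)) (T : Transformation 𝒢) (V : Selection T)
      (Ψ : Pooling V e p)
      -- the hypothesis class
      (B : ℝ) (Lφ : Fin L → ℝ≥0) (H : Set (MPNN d L e))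
      (_ : ∀ h ∈ H, h.HasBounds B Lφ) (_ : ∀ h ∈ H, SubSum Ψ h)
      -- the measurable structure on the inputs
      [MeasurableSpace (NodeInput 𝒢)] (_ : ∀ c, Measurable fun x => UD V L x c)
      -- the loss function
      (ℓ : H → Example 𝒢 → ℝ) (M : ℝ) (Lℓ : ℝ≥0)
      (_ : ∀ h, Measurable (ℓ h)) (_ : ∀ h z, 0 ≤ ℓ h z ∧ ℓ h z ≤ M)
      (_ : ∀ h z z', edist (ℓ h z) (ℓ h z') ≤ (Lℓ : ℝ≥0∞) * dInf V L z z')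
      -- the random sample, and the learning algorithm
      {Ω : Type*} [MeasurableSpace Ω] (P : Measure Ω) [IsProbabilityMeasure P]
      (μ : Measure (Example 𝒢)) {N : ℕ} (_ : 0 < N) (Z : Fin N → Ω → Example 𝒢)
      (_ : ∀ i, Measurable (Z i)) (_ : ∀ i, P.map (Z i) = μ) (_ : AssumptionA P Z)
      (𝒜 : (Fin N → Example 𝒢) → H) (δ : ℝ) (_ : 0 < δ),
      -- with probability at least `1 - δ`
      ∃ F : Set Ω, MeasurableSet F ∧ ENNReal.ofReal (1 - δ) ≤ P F ∧
        ∀ ω ∈ F, ∀ ε : ℝ, 0 < ε → ∀ K : ℕ, coveringNumber (UD V L) ε = K →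
          |expRisk μ (ℓ (𝒜 fun i => Z i ω)) - empRisk (fun i => Z i ω) (ℓ (𝒜 fun i => Z i ω))| ≤
            2 * C L Lℓ Lφ * ε +
              M * √(2 * (maxPerGraph fun i => Z i ω) *
                ((2 * K + 1) * Real.log 2 + Real.log (1 / δ)) / N) := by
  -- The loss is Lipschitz directly for `dInf`, so its constant serves as `C`.
  refine ⟨fun _ Lℓ _ => Lℓ, ?_⟩
  intro d L e p 𝒢 T V Ψ B Lφ H _ _ _ hUD ℓ M Lℓ hℓm hℓ hLip Ω _ P _ μ N hN Z hZ hμ hA 𝒜 δ hδ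
  rcases le_or_gt 1 δ with hδ1 | hδ1
  · exact ⟨∅, .empty, by simp [hδ1], fun ω hω => hω.elim⟩
  -- Almost sure equality of graphs is transitive, so the dependency graph is a disjoint union of
  -- cliques, the blocks.
  let sameSetoid : Setoid (Fin N) :=
    { r := fun i j => ∀ᵐ ω ∂P, (Z i ω).1.graph = (Z j ω).1.graph
      iseqv := ⟨fun _ => ae_of_all _ fun _ => rfl, fun h => h.mono fun _ hω => hω.symm,
        fun h h' => by filter_upwards [h, h'] with ω hω hω' using hω.trans hω'⟩ }
  let f : Fin N → Quotient sameSetoid := Quotient.mk sameSetoid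
  have hind (I J : Set (Fin N)) (hIJ : ∀ i ∈ I, ∀ j ∈ J, f i ≠ f j) :
      IndepFun (fun ω (i : I) => Z i ω) (fun ω (j : J) => Z j ω) P :=
    hA I J (Set.disjoint_left.2 fun i hi hj => hIJ i hi i hj rfl)
      fun i hi j hj hij => hIJ i hi j hj (Quotient.sound hij.2)
  obtain ⟨m, hm0, hm, hmax⟩ := exists_block_bound (𝒢 := 𝒢) hN f
  have hsame : ∀ᵐ ω ∂P, ∀ i j, f i = f j → (Z i ω).1.graph = (Z j ω).1.graph := by
    refine ae_all_iff.2 fun i => ae_all_iff.2 fun j => ?_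
    by_cases hij : f i = f j
    · have : ∀ᵐ ω ∂P, (Z i ω).1.graph = (Z j ω).1.graph := Quotient.exact hij
      exact this.mono fun ω hω _ => hω
    · exact ae_of_all _ fun ω h => absurd h hij
  have hM : 0 ≤ M := by
    obtain ⟨ω⟩ := nonempty_of_isProbabilityMeasure P
    have := hℓ (𝒜 fun i => Z i ω) (Z ⟨0, hN⟩ ω)
    exact this.1.trans this.2
  set t : ℕ → ℝ := fun K =>
    √(2 * m * ((2 * K + 1) * Real.log 2 + Real.log (1 / δ)) / N) with ht
  set gap : Ω → ℝ := fun ω =>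
    |expRisk μ (ℓ (𝒜 fun i => Z i ω)) - empRisk (fun i => Z i ω) (ℓ (𝒜 fun i => Z i ω))| with hgap
  let bad (K : ℕ) : Set Ω :=
    {ω | ∃ ε ∈ {ε : ℝ | 0 < ε ∧ coveringNumber (UD V L) ε = K}, 2 * (Lℓ : ℝ) * ε + M * t K < gap ω}
  have hbad (K : ℕ) : P (bad K) ≤ ENNReal.ofReal (δ / 2 / 2 ^ K) := by
    refine measure_exists_lt_le (by positivity) ?_
    rintro ε ⟨hε0, hε⟩
    obtain ⟨S, hS, hcard⟩ := exists_cover_of_coveringNumber_eq hε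
    obtain ⟨c, y, hc, hcy⟩ := exists_measurable_cells hUD S hS
    -- The representative keeps the label of `z`, so the infinite part of `dInf` vanishes.
    have hη (h : H) (z : Example 𝒢) : |ℓ h z - ℓ h (y (c z.1), z.2)| ≤ Lℓ * ε := by
      have hle : edist (ℓ h z) (ℓ h (y (c z.1), z.2)) ≤ Lℓ * ENNReal.ofReal ε := by
        refine (hLip h z _).trans ?_
        gcongr
        simpa [dInf] using ENNReal.ofReal_le_ofReal (hcy z.1)
      rw [edist_dist, ← ENNReal.ofReal_coe_nnreal, ← ENNReal.ofReal_mul (by positivity),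
        ENNReal.ofReal_le_ofReal_iff (by positivity), Real.dist_eq] at hle
      exact hle
    refine (le_of_eq ?_).trans ((measure_generalization_gap_gt_le hN f hZ hind hμ hm
      (q := fun z => (c z.1, z.2)) (by fun_prop) (fun k => (y k.1, k.2)) hℓm hℓ hη
      (Real.sqrt_nonneg _ : 0 ≤ t K) fun ω => 𝒜 fun i => Z i ω).trans
      (ENNReal.ofReal_le_ofReal ?_))
    · simp only [hgap, ← mul_assoc, ht]
    · rw [Fintype.card_prod, Fintype.card_fin, Fintype.card_fin, hcard]
      exact two_pow_mul_exp_threshold_le hN hm0 hδ hδ1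
  set Bad : Set Ω := (⋃ K, bad K) ∪
    {ω | ¬ ∀ i j, f i = f j → (Z i ω).1.graph = (Z j ω).1.graph} with hBad
  have hBadle : P Bad ≤ ENNReal.ofReal δ := by
    refine (measure_union_le _ _).trans ?_
    rw [ae_iff.1 hsame, add_zero]
    refine (measure_iUnion_le _).trans ((ENNReal.tsum_le_tsum hbad).trans (le_of_eq ?_))
    rw [← ENNReal.ofReal_tsum_of_nonneg (fun K => by positivity) (summable_geometric_two' δ),
      tsum_geometric_two']
  -- With an arbitrary algorithm `Bad` need not be measurable; its measurable hull has the same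
  -- measure.
  refine ⟨(toMeasurable P Bad)ᶜ, (measurableSet_toMeasurable _ _).compl, ?_, ?_⟩
  · rw [prob_compl_eq_one_sub (measurableSet_toMeasurable _ _), measure_toMeasurable,
      ENNReal.ofReal_sub _ hδ.le, ENNReal.ofReal_one]
    exact tsub_le_tsub_left hBadle _
  · intro ω hω ε hε K hK
    have hωBad : ω ∉ Bad := fun h => hω (subset_toMeasurable P Bad h)
    simp only [hBad, Set.mem_union, Set.mem_iUnion, Set.mem_ofPred_eq, not_or, not_exists,
      not_not] at hωBad
    have hgapω : gap ω ≤ 2 * Lℓ * ε + M * t K := not_lt.1 fun h => hωBad.1 K ⟨ε, ⟨hε, hK⟩, h⟩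
    have hmω : (m : ℝ) ≤ maxPerGraph fun i => Z i ω := Nat.cast_le.2 (hmax _ hωBad.2)
    have hl : 0 < Real.log (1 / δ) := Real.log_pos (one_lt_one_div hδ hδ1)
    have h2 : 0 < Real.log 2 := Real.log_pos one_lt_two
    refine hgapω.trans ?_
    gcongr
    simp only [ht]
    gcongr
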